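/- **Setting.** Consider a finite directed network without self-loops, with edge set $\mathcal E$ and a finite set $\mathcal W$ of distinct origin–destination pairs $(o_w,d_w)$, $o_w\ne d_w$, each connected by a directed path. Let $\mathcal P_w$ be the set of directed paths (as edge sets) from $o_w$ to $d_w$, $\mathcal P=\bigcup_w\mathcal P_w$, and let $Q\in\mathbb R^{\mathcal W}_{\ge0}$ be the demand. For a demand $Q'$ let $F_{Q'}$ be the set of $(q,\mu)\in\mathbb R^{\mathcal E}\times\mathbb R^{\mathcal P}$ with $\mu\ge 0$, $\sum_{p\in\mathcal P_w}\mu_p=Q'_w$ for all $w$, and $q_e=\sum_{p\ni e}\mu_p$ for all $e$. The latencies $\ell_e:[0,\infty)\to[0,\infty)$ are $l_0$-Lipschitz and twice differentiable with $\ell_e'>0$, $0\le \ell_e''\le l_1$, and $\ell_e'$ is $l_1$-Lipschitz. Let $S(q)=\sum_e q_e\ell_e(q_e)$ and let $S^\star$ be the minimum of $S(q)$ over $(q,\mu)\in F_Q$. Attack parameters are $\theta\in\Theta=\mathbb R^{|\mathcal E|^2}$ and $d\in\mathcal D=\mathbb R^{|\mathcal W|^2}$, with $\theta=\mathrm{vec}(\Phi_\theta)$,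 $d=\mathrm{vec}(\Phi_d)$ for square matrices $\Phi_\theta,\Phi_d$ and with Euclidean (i.e. Frobenius) norms; thus $\dim\Theta=|\mathcal E|^2$, $\dim\mathcal D=|\mathcal W|^2$. The poisoned equilibrium edge flow $q^*(\theta,d)$ is the minimizer of $\sum_e\int_0^{(\Phi_\theta q)_e}\ell_e(z)\,dz$ over those $q\in\mathbb R^{\mathcal E}$ for which $(\Phi_\theta q,\mu)\in F_{\Phi_dQ}$ for some $\mu$. For a weight $\gamma\in\mathbb R$ the attack utility is $$\mathcal L(\theta,d)=\tfrac12\big(\|\Phi_\theta-I\|_F^2+\|\Phi_d-I\|_F^2\big)-\gamma\,\frac{S(q^*(\theta,d))}{S^\star},$$ and $\nabla_\theta\mathcal L,\nabla_d\mathcal L$ are its partial gradients (through $q^*$). **Statement.** Fix real constants $\gamma,s,D,c_0,l_0,l_1,C_0,C_1,r_0$ with $s,r_0>0$. There are real polynomials $h_r(n,x)$, $h_{\rm sample}(n,x,y)$ and $\tilde h_{\rm sample}(n,x)$, depending only on these constants, with $h_r(n,1/\epsilon)>0$ for all $n\in\mathbb N$, $\epsilon>0$, such that the following holds for every network and game as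 above and every $(\theta,d)$ satisfying: * the latencies satisfy the stated regularity with constants $l_0,l_1$; $\ell_e(D)\le c_0$ for all $e$; $\sum_wQ_w\le D$; and $S^\star\ge s$; * $\Phi_\theta$ and $\Phi_d$ are column-stochastic; * for every $\theta'$ with $\|\theta'-\theta\|<r_0$ the minimizer $q^*(\theta',d)$ exists, is unique and lies in $\mathbb R^{\mathcal E}_{\ge0}$; and for each $e$ the function $\theta'\mapsto q^*_e(\theta',d)$ is differentiable on this ball with gradient bounded by $C_0$ and $C_1$-Lipschitz; and likewise for $d'\mapsto q^*_e(\theta,d')$ on $\|d'-d\|<r_0$. The gradients $\nabla_\theta\mathcal L$ and $\nabla_d\mathcal L$ exist at $(\theta,d)$. Moreover, let $\epsilon>0$ and $\rho=1/\max\{h_r(\dim\Theta,1/\epsilon),h_r(\dim\mathcal D,1/\epsilon)\}$. For every $0<r\le\rho$ and every integer $$m\ge\max\{h_{\rm sample}(\dim\Theta,1/\epsilon,1/r),\,h_{\rm sample}(\dim\mathcal D,1/\epsilon,1/r)\},$$ if $u_1,\dots,u_m$ are independent and uniform on the sphere of radius $r$ in $\Theta$, and $v_1,\dots,v_m$ are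 independent and uniform on the sphere of radius $r$ in $\mathcal D$, then with probability at least $1-(n/\epsilon)^{-n}$, both for $n=\dim\Theta$ and for $n=\dim\mathcal D$, one has simultaneously $$\Big\|\frac{\dim\Theta}{mr^2}\sum_{i=1}^m\mathcal L(\theta+u_i,d)\,u_i-\nabla_\theta\mathcal L(\theta,d)\Big\|\le\epsilon,\qquad \Big\|\frac{\dim\mathcal D}{mr^2}\sum_{i=1}^m\mathcal L(\theta,d+v_i)\,v_i-\nabla_d\mathcal L(\theta,d)\Big\|\le\epsilon .$$ In addition, for the radius $r=\rho$ the same conclusion holds as soon as $m\ge\max\{\tilde h_{\rm sample}(\dim\Theta,1/\epsilon),\tilde h_{\rm sample}(\dim\mathcal D,1/\epsilon)\}$, a number of samples polynomial in the dimensions and $1/\epsilon$. -/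

import Mathlib

open MeasureTheory ProbabilityTheory

noncomputable section

/-! ### Congestion games on a directed network -/

/-- A finite directed network without self-loops, together with its origin-destination (OD) pairs;
`V` are the vertices, `E` the edges and `W` the OD pairs. -/
structure TrafficNetwork (V E W : Type) where
  src : E → V
  tgt : E → V
  no_loops : ∀ e, src e ≠ tgt e
  origin : W → V
  destination : W → V
  od_ne : ∀ w, origin w ≠ destination w
  od_injective : Function.Injective fun w => (origin w, destination w)

namespace TrafficNetwork

variable {V E W : Type} (N : TrafficNetwork V E W)

/-- `l` is the list of consecutive edges of a directed walk from `a` to `b`. -/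
def IsWalk : V → V → List E → Prop
  | a, b, [] => a = b
  | a, b, e :: l => N.src e = a ∧ IsWalk (N.tgt e) b l

/-- A directed path: a directed walk that visits no vertex twice. -/
def IsPath (a b : V) (l : List E) : Prop :=
  N.IsWalk a b l ∧ (a :: l.map N.tgt).Nodup

/-- The set of directed paths of the OD pair `w`, a path being identified with its set of edges. -/
def odPaths (w : W) : Set (Finset E) :=
  {p | ∃ l, N.IsPath (N.origin w) (N.destination w) l ∧ ∀ e, e ∈ p ↔ e ∈ l}

/-- All paths of the network. -/
def PathIdx : Type := {p : Finset E // ∃ w, p ∈ N.odPaths w}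

instance [Fintype E] : Fintype N.PathIdx :=
  haveI : Finite N.PathIdx := inferInstanceAs (Finite {p : Finset E // ∃ w, p ∈ N.odPaths w})
  Fintype.ofFinite _

open Classical in
/-- Path-demand incidence matrix. -/
def pathDemand : Matrix W N.PathIdx ℝ :=
  Matrix.of fun w p => if p.1 ∈ N.odPaths w then 1 else 0

open Classical in
/-- Path-edge incidence matrix. -/
def pathEdge : Matrix E N.PathIdx ℝ :=
  Matrix.of fun e p => if e ∈ p.1 then 1 else 0

/-- The pairs `(q, μ)` of edge flow and path flow that are feasible for the demand `Q`. -/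
def feasibleFlows [Fintype E] (Q : W → ℝ) : Set ((E → ℝ) × (N.PathIdx → ℝ)) :=
  {x | (N.pathDemand).mulVec x.2 = Q ∧ (N.pathEdge).mulVec x.2 = x.1 ∧ 0 ≤ x.2}

end TrafficNetwork

/-- A nonatomic congestion game. Only the values of the latencies on `[0, ∞)` matter. -/
structure CongestionGame (V E W : Type) extends TrafficNetwork V E W where
  od_connected : ∀ w, ∃ l, toTrafficNetwork.IsWalk (origin w) (destination w) l
  latency : E → ℝ → ℝ
  demand : W → ℝ
  demand_nonneg : ∀ w, 0 ≤ demand w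

/-- Regularity of a latency function `ℓ : [0, ∞) → [0, ∞)`: it is `l₀`-Lipschitz and twice
differentiable, `ℓ' > 0`, `0 ≤ ℓ'' ≤ l₁`, and `ℓ'` is `l₁`-Lipschitz
(derivatives are one-sided at `0`). -/
structure RegularLatency (ℓ : ℝ → ℝ) (l₀ l₁ : ℝ) : Prop where
  nonneg : ∀ x, 0 ≤ x → 0 ≤ ℓ x
  lipschitz : ∀ x y, 0 ≤ x → 0 ≤ y → |ℓ x - ℓ y| ≤ l₀ * |x - y|
  differentiable : DifferentiableOn ℝ ℓ (Set.Ici 0)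
  deriv_differentiable : DifferentiableOn ℝ (derivWithin ℓ (Set.Ici 0)) (Set.Ici 0)
  deriv_pos : ∀ x, 0 ≤ x → 0 < derivWithin ℓ (Set.Ici 0) x
  deriv_lipschitz : ∀ x y, 0 ≤ x → 0 ≤ y →
    |derivWithin ℓ (Set.Ici 0) x - derivWithin ℓ (Set.Ici 0) y| ≤ l₁ * |x - y|
  second_nonneg : ∀ x, 0 ≤ x → 0 ≤ derivWithin (derivWithin ℓ (Set.Ici 0)) (Set.Ici 0) x
  second_le : ∀ x, 0 ≤ x → derivWithin (derivWithin ℓ (Set.Ici 0)) (Set.Ici 0) x ≤ l₁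

/-- Parameters of an attack operator: the vectorization of a square matrix, with the Euclidean norm
(which is the Frobenius norm of the matrix). -/
abbrev AttackParam (ι : Type) : Type := EuclideanSpace ℝ (ι × ι)

/-- The matrix `Φ` with `vec Φ = θ`. -/
def attackMatrix {ι : Type} (θ : AttackParam ι) : Matrix ι ι ℝ :=
  Matrix.of fun i j => θ (i, j)

/-- The attack constraint: nonnegative entries, and all column sums equal to one. -/
def IsColumnStochastic {ι : Type} [Fintype ι] (Φ : Matrix ι ι ℝ) : Prop :=
  (∀ i j, 0 ≤ Φ i j) ∧ Φ.transpose.mulVec 1 = 1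

/-- Squared Frobenius norm. -/
def frobeniusSq {ι : Type} [Fintype ι] (M : Matrix ι ι ℝ) : ℝ := ∑ i, ∑ j, M i j ^ 2

namespace CongestionGame

variable {V E W : Type} [Fintype E] [Fintype W] (G : CongestionGame V E W)

/-- Aggregated latency of an edge flow. -/
def aggregatedLatency (q : E → ℝ) : ℝ := ∑ e, q e * G.latency e (q e)

/-- `q` is a system optimum edge flow: it minimizes the aggregated latency over feasible flows. -/
def IsSystemOptimum (q : E → ℝ) : Prop :=
  (∃ μ, (q, μ) ∈ G.feasibleFlows G.demand) ∧
    ∀ q' μ', (q', μ') ∈ G.feasibleFlows G.demand →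
      G.aggregatedLatency q ≤ G.aggregatedLatency q'

/-- The system optimum edge flow. -/
def optimalFlow : E → ℝ := Classical.epsilon G.IsSystemOptimum

/-- The optimal aggregated latency. -/
def optimalLatency : ℝ := G.aggregatedLatency G.optimalFlow

/-- Beckmann potential. -/
def beckmann (x : E → ℝ) : ℝ := ∑ e, ∫ z in (0 : ℝ)..x e, G.latency e z

/-- The edge flows `q` such that `Φ_θ q` is feasible for the poisoned demand `Φ_d Q`. -/
def poisonedFeasible (θ : AttackParam E) (d : AttackParam W) : Set (E → ℝ) :=
  {q | ∃ μ, ((attackMatrix θ).mulVec q, μ) ∈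
    G.feasibleFlows ((attackMatrix d).mulVec G.demand)}

/-- `q` is an edge flow at the `(θ, d)`-poisoned Wardrop equilibrium: it solves the parameterized
Beckmann program. -/
def IsPoisonedEquilibrium (θ : AttackParam E) (d : AttackParam W) (q : E → ℝ) : Prop :=
  q ∈ G.poisonedFeasible θ d ∧
    ∀ q' ∈ G.poisonedFeasible θ d,
      G.beckmann ((attackMatrix θ).mulVec q) ≤ G.beckmann ((attackMatrix θ).mulVec q')

/-- The edge flow `q*(θ, d)` at the poisoned Wardrop equilibrium. -/
def poisonedFlow (θ : AttackParam E) (d : AttackParam W) : E → ℝ :=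
  Classical.epsilon (G.IsPoisonedEquilibrium θ d)

/-- Poisoned price of anarchy. -/
def poisonedPoA (θ : AttackParam E) (d : AttackParam W) : ℝ :=
  G.aggregatedLatency (G.poisonedFlow θ d) / G.optimalLatency

open Classical in
/-- The attack utility `𝓛((θ, d), q*(θ, d))`, with payoff weight `γ`. -/
def attackUtility (γ : ℝ) (θ : AttackParam E) (d : AttackParam W) : ℝ :=
  1 / 2 * (frobeniusSq (attackMatrix θ - 1) + frobeniusSq (attackMatrix d - 1))
    - γ * G.poisonedPoA θ d

/-- The parameterized Beckmann program has a unique minimizer, and this minimizer is a genuine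
edge flow, i.e. it lies in the domain `[0, ∞)` of the latencies. -/
def WellPosed (θ : AttackParam E) (d : AttackParam W) : Prop :=
  (∃! q, G.IsPoisonedEquilibrium θ d q) ∧ ∀ e, 0 ≤ G.poisonedFlow θ d e

end CongestionGame

/-- On the ball of radius `ρ` around `x`, the function `f` is differentiable with a gradient that is
bounded by `C₀` and `C₁`-Lipschitz. -/
structure RegularGradientNear {X : Type} [NormedAddCommGroup X] [InnerProductSpace ℝ X]
    [CompleteSpace X] (f : X → ℝ) (x : X) (ρ C₀ C₁ : ℝ) : Prop where
  differentiable : ∀ y ∈ Metric.ball x ρ, DifferentiableAt ℝ f y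
  bound : ∀ y ∈ Metric.ball x ρ, ‖gradient f y‖ ≤ C₀
  lipschitz : ∀ y ∈ Metric.ball x ρ, ∀ z ∈ Metric.ball x ρ,
    ‖gradient f y - gradient f z‖ ≤ C₁ * ‖y - z‖

/-- The equilibrium edge flows are well defined and smooth on the `ρ`-balls around `θ` and `d`. -/
structure CongestionGame.RegularEquilibriumNear {V E W : Type} [Fintype E] [Fintype W]
    (G : CongestionGame V E W) (θ : AttackParam E) (d : AttackParam W) (ρ C₀ C₁ : ℝ) : Prop where
  wellPosed_left : ∀ θ' ∈ Metric.ball θ ρ, G.WellPosed θ' d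
  wellPosed_right : ∀ d' ∈ Metric.ball d ρ, G.WellPosed θ d'
  gradient_left : ∀ e, RegularGradientNear (fun θ' => G.poisonedFlow θ' d e) θ ρ C₀ C₁
  gradient_right : ∀ e, RegularGradientNear (fun d' => G.poisonedFlow θ d' e) d ρ C₀ C₁

/-! ### One-point gradient estimation -/

/-- The uniform probability measure on the sphere of radius `r` centred at the origin. -/
def uniformSphere (X : Type) [NormedAddCommGroup X] [InnerProductSpace ℝ X]
    [FiniteDimensional ℝ X] [MeasurableSpace X] [BorelSpace X] (r : ℝ) : Measure X :=
  (((volume : Measure X).toSphere Set.univ)⁻¹ • (volume : Measure X).toSphere).map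
    fun x : Metric.sphere (0 : X) 1 => r • (x : X)

/-- The sample average `dim / (m r²) ∑ᵢ f (x + uᵢ) uᵢ`. -/
def onePointEstimate {X : Type} [NormedAddCommGroup X] [InnerProductSpace ℝ X]
    (f : X → ℝ) (x : X) (r : ℝ) {m : ℕ} (u : Fin m → X) : X :=
  ((Module.finrank ℝ X : ℝ) / (m * r ^ 2)) • ∑ i, f (x + u i) • u i

/-- With `m` independent uniform samples `uᵢ` and `vᵢ` from the spheres of radius `r`, both sample
averages are `ε`-close to `∇_θ 𝓛` and `∇_d 𝓛`, with probability at least `1 - (n / ε) ^ (-n)`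
for `n = dim Θ` as well as for `n = dim 𝒟`. -/
def CongestionGame.EstimatesGradients {V E W : Type} [Fintype E] [Fintype W]
    (G : CongestionGame V E W) (γ : ℝ) (θ : AttackParam E) (d : AttackParam W)
    (ε r : ℝ) (m : ℕ) : Prop :=
  ∀ (Ω : Type) [MeasurableSpace Ω] (P : Measure Ω) [IsProbabilityMeasure P]
    (u : Fin m → Ω → AttackParam E) (v : Fin m → Ω → AttackParam W),
    iIndepFun u P → (∀ i, HasLaw (u i) (uniformSphere (AttackParam E) r) P) →
    iIndepFun v P → (∀ i, HasLaw (v i) (uniformSphere (AttackParam W) r) P) →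
    ∀ n : ℕ, (n = Module.finrank ℝ (AttackParam E) ∨ n = Module.finrank ℝ (AttackParam W)) →
      1 - ((n : ℝ) / ε) ^ (-(n : ℤ)) ≤ P.real {ω |
        ‖onePointEstimate (fun θ' => G.attackUtility γ θ' d) θ r (fun i => u i ω)
            - gradient (fun θ' => G.attackUtility γ θ' d) θ‖ ≤ ε ∧
        ‖onePointEstimate (fun d' => G.attackUtility γ θ d') d r (fun i => v i ω)
            - gradient (fun d' => G.attackUtility γ θ d') d‖ ≤ ε}

end

/-!
The estimator `dim X / (m r²) ∑ f (x + uᵢ) uᵢ` needs only two facts about `f`: a bound `B` on `|f|`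
and a first-order expansion `f (x + u) = f x + ⟪∇f x, u⟫ + O(K ‖u‖²)`, both on the sphere of radius
`r`.

* Bias. The uniform measure on the sphere is invariant under linear isometries, so it has mean zero
  and covariance `r² / dim X` times the identity (`integral_inner_mul_inner_uniformSphere`).
  Multiplying the expansion by `u` and averaging, the constant term disappears, the linear term gives
  `∇f x`, and the remainder costs `O(dim X * K * r)` in each coordinate
  (`abs_integral_onePoint_sub_inner_le`). Neither smoothing of `f` nor the divergence theorem is
  needed.
* Fluctuation. In each coordinate of an orthonormal basis the samples are bounded by `dim X * B / r`,
  so Hoeffding's inequality and a union bound give an exponential tail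
  (`measureReal_onePointEstimate_le`).

For the attack utility, `B` and `K` grow polynomially with the dimensions
(`CongestionGame.exists_uniform_expansion`): column-stochastic matrices preserve total mass, so every
edge of the poisoned flow carries at most `|E| * D`, and the cost `x * ℓ x` has on `[0, ∞)` a
second-order Taylor estimate that survives composition with the flow. A failure probability
`(n / ε) ^ (-n)` is then reached with polynomially many samples, because `n * log (n / ε) ≤ n² / ε`
(`exp_tail_le`).
-/

/-! ### The uniform measure on a sphere -/

section UniformSphere

open Metric
open scoped Pointwise

variable {X : Type} [NormedAddCommGroup X] [InnerProductSpace ℝ X] [MeasurableSpace X]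
  [BorelSpace X]

lemma measurable_smul_sphere (r : ℝ) : Measurable fun x : sphere (0 : X) 1 => r • (x : X) :=
  (continuous_subtype_val.const_smul r).measurable

variable [FiniteDimensional ℝ X]

instance isProbabilityMeasure_uniformSphere [Nontrivial X] (r : ℝ) :
    IsProbabilityMeasure (uniformSphere X r) := by
  have h : IsProbabilityMeasure
      (((volume : Measure X).toSphere Set.univ)⁻¹ • (volume : Measure X).toSphere) := by
    refine ⟨?_⟩
    rw [Measure.smul_apply, smul_eq_mul]
    refine ENNReal.inv_mul_cancel ?_ (measure_ne_top _ _)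
    rw [Ne, Measure.measure_univ_eq_zero]
    exact Measure.toSphere_ne_zero _
  exact Measure.isProbabilityMeasure_map (measurable_smul_sphere r).aemeasurable

lemma ae_norm_eq_uniformSphere {r : ℝ} (hr : 0 ≤ r) : ∀ᵐ u ∂uniformSphere X r, ‖u‖ = r := by
  unfold uniformSphere
  rw [ae_map_iff (measurable_smul_sphere r).aemeasurable
    (measurableSet_eq_fun measurable_norm measurable_const)]
  refine Filter.Eventually.of_forall fun x => ?_
  have hx : ‖(x : X)‖ = 1 := by simp
  rw [norm_smul, hx, mul_one, Real.norm_of_nonneg hr]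

lemma measurePreserving_toSphere (L : X ≃ₗᵢ[ℝ] X) :
    MeasurePreserving (fun x : sphere (0 : X) 1 => (⟨L x, by simp⟩ : sphere (0 : X) 1))
      (volume : Measure X).toSphere (volume : Measure X).toSphere := by
  have hm : Measurable (fun x : sphere (0 : X) 1 => (⟨L x, by simp⟩ : sphere (0 : X) 1)) :=
    (Continuous.subtype_mk (L.continuous.comp continuous_subtype_val) _).measurable
  refine ⟨hm, ?_⟩
  ext s hs
  rw [Measure.map_apply hm hs, Measure.toSphere_apply' _ hs, Measure.toSphere_apply' _ (hm hs)]
  conv_rhs => rw [← L.measurePreserving.measure_preimage_emb L.toHomeomorph.measurableEmbedding]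
  congr 2
  ext y
  simp only [Set.mem_smul, Set.mem_image, Set.mem_preimage, Subtype.exists, exists_and_right,
    exists_eq_right]
  constructor
  · rintro ⟨a, ha, z, ⟨hz, hzs⟩, rfl⟩
    exact ⟨a, ha, L z, ⟨by simpa using hz, hzs⟩, by simp⟩
  · rintro ⟨a, ha, z, ⟨hz, hzs⟩, h⟩
    refine ⟨a, ha, L.symm z, ⟨by simpa using hz, by simpa using hzs⟩, ?_⟩
    apply L.injective
    simpa using h

lemma measurePreserving_uniformSphere (L : X ≃ₗᵢ[ℝ] X) (r : ℝ) :
    MeasurePreserving L (uniformSphere X r) (uniformSphere X r) := by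
  refine ⟨L.continuous.measurable, ?_⟩
  unfold uniformSphere
  generalize ((volume : Measure X).toSphere Set.univ)⁻¹ = c
  have h := (measurePreserving_toSphere L).map_eq
  rw [Measure.map_map L.continuous.measurable (measurable_smul_sphere r)]
  conv_rhs => rw [← h, ← Measure.map_smul,
    Measure.map_map (measurable_smul_sphere r) (measurePreserving_toSphere L).measurable]
  congr 1
  ext x
  simp

lemma integral_comp_uniformSphere (L : X ≃ₗᵢ[ℝ] X) (r : ℝ) (g : X → ℝ) :
    ∫ u, g (L u) ∂uniformSphere X r = ∫ u, g u ∂uniformSphere X r :=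
  (measurePreserving_uniformSphere L r).integral_comp L.toHomeomorph.measurableEmbedding g

lemma integral_inner_uniformSphere (r : ℝ) (h : X) :
    ∫ u, inner ℝ h u ∂uniformSphere X r = 0 := by
  have := integral_comp_uniformSphere (LinearIsometryEquiv.neg ℝ) r (fun u : X => inner ℝ h u)
  simp only [LinearIsometryEquiv.coe_neg, inner_neg_right, integral_neg] at this
  linarith

lemma integrable_inner_uniformSphere [Nontrivial X] {r : ℝ} (hr : 0 ≤ r) (h : X) :
    Integrable (fun u => inner ℝ h u) (uniformSphere X r) := by
  refine Integrable.of_bound (C := ‖h‖ * r)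
    (continuous_const.inner continuous_id).measurable.aestronglyMeasurable ?_
  filter_upwards [ae_norm_eq_uniformSphere hr] with u hu
  simpa [hu] using norm_inner_le_norm (𝕜 := ℝ) h u

lemma integrable_inner_mul_inner_uniformSphere [Nontrivial X] {r : ℝ} (hr : 0 ≤ r) (g h : X) :
    Integrable (fun u => inner ℝ g u * inner ℝ h u) (uniformSphere X r) := by
  refine Integrable.of_bound (C := (‖g‖ * r) * (‖h‖ * r))
    ((continuous_const.inner continuous_id).mul
      (continuous_const.inner continuous_id)).measurable.aestronglyMeasurable ?_
  filter_upwards [ae_norm_eq_uniformSphere hr] with u hu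
  rw [norm_mul]
  gcongr
  · simpa [hu] using norm_inner_le_norm (𝕜 := ℝ) g u
  · simpa [hu] using norm_inner_le_norm (𝕜 := ℝ) h u

/-- A reflection exchanges any two vectors of equal length, so the second moment of `⟪g, u⟫`
depends on `‖g‖` only. -/
lemma integral_inner_sq_uniformSphere_congr (r : ℝ) {g h : X} (hgh : ‖g‖ = ‖h‖) :
    ∫ u, inner ℝ g u ^ 2 ∂uniformSphere X r = ∫ u, inner ℝ h u ^ 2 ∂uniformSphere X r := by
  set L : X ≃ₗᵢ[ℝ] X := (ℝ ∙ (g - h))ᗮ.reflection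
  have hL : L g = h := Submodule.reflection_sub hgh
  rw [← integral_comp_uniformSphere L r (fun u => inner ℝ h u ^ 2)]
  simp_rw [← hL, L.inner_map_map]

lemma integral_inner_sq_uniformSphere [Nontrivial X] {r : ℝ} (hr : 0 ≤ r) (g : X) :
    ∫ u, inner ℝ g u ^ 2 ∂uniformSphere X r = r ^ 2 / Module.finrank ℝ X * ‖g‖ ^ 2 := by
  set b := stdOrthonormalBasis ℝ X
  set n := Module.finrank ℝ X
  have hn : 0 < n := Module.finrank_pos
  have hn' : (0 : ℝ) < n := by exact_mod_cast hn
  let i₀ : Fin n := ⟨0, hn⟩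
  have hsum : ∑ i, ∫ u, inner ℝ (b i) u ^ 2 ∂uniformSphere X r = r ^ 2 := by
    rw [← integral_finsetSum]
    · have : ∀ᵐ u ∂uniformSphere X r, ∑ i, inner ℝ (b i) u ^ 2 = r ^ 2 := by
        filter_upwards [ae_norm_eq_uniformSphere hr] with u hu
        rw [← hu, ← b.sum_sq_norm_inner_right u]
        simp
      rw [integral_congr_ae this]
      simp
    · intro i _
      simpa [sq] using integrable_inner_mul_inner_uniformSphere hr (b i) (b i)
  have hi : ∀ i, ∫ u, inner ℝ (b i) u ^ 2 ∂uniformSphere X r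
      = ∫ u, inner ℝ (b i₀) u ^ 2 ∂uniformSphere X r := fun i =>
    integral_inner_sq_uniformSphere_congr r (by simp)
  simp_rw [hi] at hsum
  simp only [Finset.sum_const, Finset.card_univ, Fintype.card_fin, nsmul_eq_mul] at hsum
  have hg : ∫ u, inner ℝ g u ^ 2 ∂uniformSphere X r
      = ∫ u, inner ℝ (‖g‖ • b i₀) u ^ 2 ∂uniformSphere X r :=
    integral_inner_sq_uniformSphere_congr r (by simp [norm_smul])
  rw [hg]
  simp_rw [real_inner_smul_left, mul_pow]
  rw [integral_const_mul, ← hsum]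
  field_simp

/-- The uniform measure on the sphere is isotropic: its covariance is `r² / dim X` times the inner
product. -/
lemma integral_inner_mul_inner_uniformSphere [Nontrivial X] {r : ℝ} (hr : 0 ≤ r) (g h : X) :
    ∫ u, inner ℝ g u * inner ℝ h u ∂uniformSphere X r
      = r ^ 2 / Module.finrank ℝ X * inner ℝ g h := by
  have h1 := integral_inner_sq_uniformSphere hr (g + h)
  have h2 := integral_inner_sq_uniformSphere hr (g - h)
  have hpol : ∀ u : X, inner ℝ g u * inner ℝ h u
      = 4⁻¹ * (inner ℝ (g + h) u ^ 2 - inner ℝ (g - h) u ^ 2) := by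
    intro u
    rw [inner_add_left, inner_sub_left]
    ring
  have hint : ∀ x : X, Integrable (fun u => inner ℝ x u ^ 2) (uniformSphere X r) := fun x => by
    simpa [sq] using integrable_inner_mul_inner_uniformSphere hr x x
  simp_rw [hpol]
  rw [integral_const_mul, integral_sub (hint _) (hint _), h1, h2, norm_add_sq_real,
    norm_sub_sq_real]
  ring

end UniformSphere

/-! ### Concentration of the one-point estimate -/

/-- Two-sided Hoeffding inequality for the deviation of a sum of `m` independent variables with
values in `[-A, A]` from its mean. -/
lemma measureReal_abs_sum_sub_integral_ge_le {Ω : Type} [MeasurableSpace Ω] {P : Measure Ω}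
    [IsProbabilityMeasure P] {m : ℕ} {Y : Fin m → Ω → ℝ} (hind : iIndepFun Y P)
    (hY : ∀ i, AEMeasurable (Y i) P) {A : ℝ} (hb : ∀ i, ∀ᵐ ω ∂P, |Y i ω| ≤ A) {t : ℝ}
    (ht : 0 ≤ t) :
    P.real {ω | m * t ≤ |∑ i, (Y i ω - P[Y i])|} ≤ 2 * Real.exp (-(m * t ^ 2 / (2 * A ^ 2))) := by
  have hsub : ∀ i ∈ (Finset.univ : Finset (Fin m)),
      HasSubgaussianMGF (fun ω => Y i ω - P[Y i]) ((‖A - -A‖₊ / 2) ^ 2) P := fun i _ =>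
    hasSubgaussianMGF_of_mem_Icc (hY i) ((hb i).mono fun ω h => abs_le.1 h)
  have hind' : iIndepFun (fun i ω => Y i ω - P[Y i]) P :=
    hind.comp (fun i (y : ℝ) => y - ∫ ω, Y i ω ∂P) fun i => measurable_id.sub_const _
  have hsub' : ∀ i ∈ (Finset.univ : Finset (Fin m)),
      HasSubgaussianMGF (fun ω => -(Y i ω - P[Y i])) ((‖A - -A‖₊ / 2) ^ 2) P := fun i hi =>
    (hsub i hi).neg
  have hind'' : iIndepFun (fun i ω => -(Y i ω - P[Y i])) P :=
    hind'.comp (fun _ (y : ℝ) => -y) fun _ => measurable_neg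
  have hmt : 0 ≤ m * t := by positivity
  have h1 := HasSubgaussianMGF.measure_sum_ge_le_of_iIndepFun hind' hsub hmt
  have h2 := HasSubgaussianMGF.measure_sum_ge_le_of_iIndepFun hind'' hsub' hmt
  have hexp : -(m * t) ^ 2 / (2 * ((∑ _i : Fin m, (‖A - -A‖₊ / 2) ^ 2 : NNReal) : ℝ))
      = -(m * t ^ 2 / (2 * A ^ 2)) := by
    have : ((∑ _i : Fin m, (‖A - -A‖₊ / 2) ^ 2 : NNReal) : ℝ) = m * A ^ 2 := by
      push_cast
      rw [Finset.sum_const, Finset.card_univ, Fintype.card_fin, nsmul_eq_mul, div_pow,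
        Real.norm_eq_abs, sq_abs]
      ring
    rw [this]
    rcases eq_or_ne (m : ℝ) 0 with hm | hm
    · simp [hm]
    · rcases eq_or_ne A 0 with hA | hA
      · simp [hA]
      · field_simp
  rw [hexp] at h1 h2
  calc P.real {ω | m * t ≤ |∑ i, (Y i ω - P[Y i])|}
      ≤ P.real ({ω | m * t ≤ ∑ i, (Y i ω - P[Y i])} ∪ {ω | m * t ≤ ∑ i, -(Y i ω - P[Y i])}) := by
        refine measureReal_mono (fun ω hω => ?_)
        rcases le_abs.1 (Set.mem_ofPred.1 hω) with h | h
        · exact Or.inl h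
        · exact Or.inr (by simpa only [Set.mem_ofPred_eq, Finset.sum_neg_distrib] using h)
    _ ≤ _ := measureReal_union_le _ _
    _ ≤ _ := by linarith

section OnePoint

open Metric

variable {X : Type} [NormedAddCommGroup X] [InnerProductSpace ℝ X] [FiniteDimensional ℝ X]
  [MeasurableSpace X] [BorelSpace X]

lemma aemeasurable_uniformSphere_of_continuousOn {r : ℝ} (hr : 0 ≤ r) {f : X → ℝ}
    (hf : ContinuousOn f (sphere 0 r)) : AEMeasurable f (uniformSphere X r) := by
  have h := hf.aemeasurable (μ := uniformSphere X r) isClosed_sphere.measurableSet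
  rwa [Measure.restrict_eq_self_of_ae_mem] at h
  filter_upwards [ae_norm_eq_uniformSphere hr] with u hu
  simpa using hu

/-- A function with the first-order expansion `f (x + u) = f x + ⟪g, u⟫ + O(K r²)` on the sphere of
radius `r`: each coordinate of the mean of `dim X / r² • f (x + u) • u` is within `dim X * K * r`
of the coordinate of `g`, because the constant term averages to zero and the linear one, by
isotropy, to `g`. -/
lemma abs_integral_onePoint_sub_inner_le [Nontrivial X] {f : X → ℝ} {x g : X} {r K : ℝ}
    (hr : 0 < r) (hcont : ContinuousOn (fun u => f (x + u)) (sphere 0 r))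
    (hK : ∀ u, ‖u‖ = r → |f (x + u) - f x - inner ℝ g u| ≤ K * r ^ 2) {b : X} (hb : ‖b‖ = 1) :
    |∫ u, Module.finrank ℝ X / r ^ 2 * (f (x + u) * inner ℝ b u) ∂uniformSphere X r
      - inner ℝ b g| ≤ Module.finrank ℝ X * K * r := by
  set σ := uniformSphere X r
  set n := Module.finrank ℝ X
  have hn' : (0 : ℝ) < n := by exact_mod_cast (Module.finrank_pos : 0 < Module.finrank ℝ X)
  have hbm : Measurable fun u : X => inner ℝ b u := (continuous_const.inner continuous_id).measurable
  have hgm : Measurable fun u : X => inner ℝ g u := (continuous_const.inner continuous_id).measurable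
  have hfm := aemeasurable_uniformSphere_of_continuousOn hr.le hcont
  have hbd : ∀ᵐ u ∂σ, ‖(f (x + u) - f x - inner ℝ g u) * inner ℝ b u‖ ≤ K * r ^ 2 * r := by
    filter_upwards [ae_norm_eq_uniformSphere hr.le] with u hu
    rw [norm_mul]
    have h1 := hK u hu
    gcongr
    · exact (abs_nonneg _).trans h1
    · exact h1
    · simpa [hu, hb] using norm_inner_le_norm (𝕜 := ℝ) b u
  have hRint : Integrable (fun u => (f (x + u) - f x - inner ℝ g u) * inner ℝ b u) σ :=
    Integrable.of_bound (C := K * r ^ 2 * r) (((hfm.sub_const _).sub hgm.aemeasurable).mul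
      hbm.aemeasurable).aestronglyMeasurable
      hbd
  have hsplit : ∀ u, n / r ^ 2 * (f (x + u) * inner ℝ b u)
      = n / r ^ 2 * ((f (x + u) - f x - inner ℝ g u) * inner ℝ b u
        + (f x * inner ℝ b u + inner ℝ g u * inner ℝ b u)) := fun u => by ring
  have hR := norm_integral_le_of_norm_le_const hbd
  simp only [probReal_univ, mul_one] at hR
  have hmain : ∫ u, n / r ^ 2 * (f (x + u) * inner ℝ b u) ∂σ - inner ℝ b g
      = n / r ^ 2 * ∫ u, (f (x + u) - f x - inner ℝ g u) * inner ℝ b u ∂σ := by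
    have i1 : Integrable (fun u => f x * inner ℝ b u) σ :=
      (integrable_inner_uniformSphere hr.le b).const_mul _
    have i2 := integrable_inner_mul_inner_uniformSphere hr.le g b
    simp_rw [hsplit]
    rw [integral_const_mul, integral_add hRint (by exact i1.add i2), integral_add i1 i2, integral_const_mul,
      integral_inner_uniformSphere, integral_inner_mul_inner_uniformSphere hr.le,
      real_inner_comm g b]
    generalize ∫ u, (f (x + u) - f x - inner ℝ g u) * inner ℝ b u ∂σ = R
    change n / r ^ 2 * (R + (f x * 0 + r ^ 2 / n * inner ℝ g b)) - inner ℝ g b = _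
    field_simp
    ring
  rw [hmain, abs_mul, abs_of_nonneg (by positivity)]
  calc n / r ^ 2 * |∫ u, (f (x + u) - f x - inner ℝ g u) * inner ℝ b u ∂σ|
      ≤ n / r ^ 2 * (K * r ^ 2 * r) := by gcongr; exact hR
    _ = n * K * r := by field_simp

/-- Concentration of the one-point estimate around a first-order coefficient `g` of `f` at `x`.
Half of the tolerance `ε` pays for the bias, by `hbias`, and half for the fluctuation, by
Hoeffding's inequality in each coordinate of an orthonormal basis. -/
lemma measureReal_onePointEstimate_le {f : X → ℝ} {x g : X} {r B K ε : ℝ} (hr : 0 < r)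
    (hε : 0 < ε) (hcont : ContinuousOn (fun u => f (x + u)) (sphere 0 r))
    (hB : ∀ u, ‖u‖ = r → |f (x + u)| ≤ B)
    (hK : ∀ u, ‖u‖ = r → |f (x + u) - f x - inner ℝ g u| ≤ K * r ^ 2)
    (hbias : 2 * Module.finrank ℝ X ^ 2 * K * r ≤ ε) {m : ℕ} (hm : 0 < m)
    {Ω : Type} [MeasurableSpace Ω] {P : Measure Ω} [IsProbabilityMeasure P] {u : Fin m → Ω → X}
    (hind : iIndepFun u P) (hlaw : ∀ i, HasLaw (u i) (uniformSphere X r) P) :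
    P.real {ω | ε < ‖onePointEstimate f x r (fun i => u i ω) - g‖}
      ≤ 2 * Module.finrank ℝ X
        * Real.exp (-(m * ε ^ 2 * r ^ 2 / (8 * Module.finrank ℝ X ^ 4 * B ^ 2))) := by
  rcases subsingleton_or_nontrivial X with hX | hX
  · have : {ω | ε < ‖onePointEstimate f x r (fun i => u i ω) - g‖} = ∅ := by
      ext ω
      simp [Subsingleton.elim (onePointEstimate f x r (fun i => u i ω) - g) 0, hε.le]
    rw [this, measureReal_empty]
    positivity
  set n := Module.finrank ℝ X
  have hn' : (0 : ℝ) < n := by exact_mod_cast (Module.finrank_pos : 0 < Module.finrank ℝ X)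
  have hm' : (0 : ℝ) < m := by exact_mod_cast hm
  set b := stdOrthonormalBasis ℝ X
  set σ := uniformSphere X r
  let φ : Fin n → X → ℝ := fun j v => n / r ^ 2 * (f (x + v) * inner ℝ (b j) v)
  have hφm : ∀ j, AEMeasurable (φ j) σ := fun j =>
    ((aemeasurable_uniformSphere_of_continuousOn hr.le hcont).mul
      (continuous_const.inner continuous_id).measurable.aemeasurable).const_mul _
  have hφb : ∀ j, ∀ᵐ v ∂σ, |φ j v| ≤ n * B / r := by
    intro j
    filter_upwards [ae_norm_eq_uniformSphere hr.le] with v hv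
    have h1 : |inner ℝ (b j) v| ≤ r := by
      simpa [hv] using norm_inner_le_norm (𝕜 := ℝ) (b j) v
    have h2 := hB v hv
    rw [abs_mul, abs_mul, abs_of_nonneg (by positivity)]
    calc n / r ^ 2 * (|f (x + v)| * |inner ℝ (b j) v|) ≤ n / r ^ 2 * (B * r) := by
          gcongr
          exact (abs_nonneg _).trans h2
      _ = n * B / r := by field_simp
  have hc : ∀ j i, P[fun ω => φ j (u i ω)] = ∫ v, φ j v ∂σ := fun j i =>
    (hlaw i).integral_comp (hφm j).aestronglyMeasurable
  have htail : ∀ j, P.real {ω | m * (ε / (2 * n)) ≤ |∑ i, (φ j (u i ω) - ∫ v, φ j v ∂σ)|}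
      ≤ 2 * Real.exp (-(m * ε ^ 2 * r ^ 2 / (8 * n ^ 4 * B ^ 2))) := by
    intro j
    have hφu : ∀ i, AEMeasurable (φ j) (P.map (u i)) := fun i => by
      rw [(hlaw i).map_eq]; exact hφm j
    have hind' : iIndepFun (fun i ω => φ j (u i ω)) P :=
      hind.comp₀ (fun _ => φ j) (fun i => (hlaw i).aemeasurable) hφu
    have h := measureReal_abs_sum_sub_integral_ge_le hind'
      (fun i => (hφu i).comp_aemeasurable (hlaw i).aemeasurable) (A := n * B / r)
      (fun i => by
        have := hφb j
        rw [← (hlaw i).map_eq] at this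
        exact ae_of_ae_map (hlaw i).aemeasurable this)
      (t := ε / (2 * n)) (by positivity)
    simp only [hc] at h
    refine h.trans_eq ?_
    congr 3
    field_simp
    norm_num
  calc P.real {ω | ε < ‖onePointEstimate f x r (fun i => u i ω) - g‖}
      ≤ P.real (⋃ j, {ω | m * (ε / (2 * n)) ≤ |∑ i, (φ j (u i ω) - ∫ v, φ j v ∂σ)|}) := by
        refine measureReal_mono fun ω hω => ?_
        by_contra hnot
        simp only [Set.mem_iUnion, Set.mem_ofPred_eq, not_exists, not_le] at hnot
        refine absurd (Set.mem_ofPred.1 hω) (not_lt.2 ?_)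
        have hcoord : ∀ j, |inner ℝ (b j) (onePointEstimate f x r (fun i => u i ω) - g)|
            ≤ ε / n := by
          intro j
          have e1 : inner ℝ (b j) (onePointEstimate f x r (fun i => u i ω) - g)
              = (∑ i, (φ j (u i ω) - ∫ v, φ j v ∂σ)) / m + (∫ v, φ j v ∂σ - inner ℝ (b j) g) := by
            simp only [onePointEstimate, inner_sub_right, inner_smul_right, inner_sum,
              Finset.sum_sub_distrib, Finset.sum_const, Finset.card_univ, Fintype.card_fin,
              nsmul_eq_mul, φ, ← Finset.mul_sum]
            change (n : ℝ) / _ * _ - _ = _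
            field_simp
            ring
          have e2 : |(∑ i, (φ j (u i ω) - ∫ v, φ j v ∂σ)) / m| ≤ ε / (2 * n) := by
            rw [abs_div, abs_of_pos hm', div_le_iff₀ hm', mul_comm]
            exact (hnot j).le
          have e3 := abs_integral_onePoint_sub_inner_le hr hcont hK (b := b j) (by simp)
          have e4 : n * K * r ≤ ε / (2 * n) := by
            rw [le_div_iff₀ (by positivity)]
            linarith
          rw [e1]
          refine (abs_add_le _ _).trans ((add_le_add e2 (e3.trans e4)).trans_eq ?_)
          field_simp
          norm_num
        rw [← b.sum_repr' (onePointEstimate f x r (fun i => u i ω) - g)]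
        refine (norm_sum_le_of_le _ (f := fun j => _) (n := fun _ => ε / n) fun j _ => ?_).trans_eq ?_
        · rw [norm_smul, b.norm_eq_one, mul_one]
          exact hcoord j
        · simp only [Finset.sum_const, Finset.card_univ, Fintype.card_fin, nsmul_eq_mul]
          change (n : ℝ) * _ = _
          field_simp
    _ ≤ ∑ j, P.real {ω | m * (ε / (2 * n)) ≤ |∑ i, (φ j (u i ω) - ∫ v, φ j v ∂σ)|} :=
        measureReal_iUnion_fintype_le _
    _ ≤ ∑ _j : Fin n, 2 * Real.exp (-(m * ε ^ 2 * r ^ 2 / (8 * n ^ 4 * B ^ 2))) :=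
        Finset.sum_le_sum fun j _ => htail j
    _ = _ := by
        simp only [Finset.sum_const, Finset.card_univ, Fintype.card_fin, nsmul_eq_mul]
        ring

end OnePoint

/-! ### Bounds on flows and latencies -/

namespace TrafficNetwork

variable {V E W : Type} [Fintype E] [Fintype W] {N : TrafficNetwork V E W}

/-- No edge carries more than the total demand. A path may serve several OD pairs, hence the
inequality between total path flow and total demand. -/
lemma edgeFlow_le_sum_demand {Q : W → ℝ} {q : E → ℝ} {μ : N.PathIdx → ℝ}
    (h : (q, μ) ∈ N.feasibleFlows Q) (e : E) : q e ≤ ∑ w, Q w := by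
  classical
  obtain ⟨h1, h2, h3⟩ := h
  dsimp only at h1 h2 h3
  calc q e ≤ ∑ p, μ p := by
        rw [← h2]
        refine Finset.sum_le_sum fun p _ => ?_
        have hp := h3 p
        simp only [Pi.zero_apply] at hp
        simp only [pathEdge, Matrix.of_apply]
        split_ifs <;> simp [hp]
    _ ≤ ∑ p, ∑ w, N.pathDemand w p * μ p := by
        refine Finset.sum_le_sum fun p _ => ?_
        have hp := h3 p
        simp only [Pi.zero_apply] at hp
        obtain ⟨w, hw⟩ := p.2
        refine le_trans ?_ (Finset.single_le_sum (f := fun w => N.pathDemand w p * μ p)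
          (fun w _ => ?_) (Finset.mem_univ w))
        · simp [pathDemand, hw]
        · simp only [pathDemand, Matrix.of_apply]
          split_ifs <;> simp [hp]
    _ = ∑ w, Q w := by
        rw [Finset.sum_comm, ← h1]
        rfl

end TrafficNetwork

lemma IsColumnStochastic.sum_mulVec {ι : Type} [Fintype ι] {Φ : Matrix ι ι ℝ}
    (h : IsColumnStochastic Φ) (v : ι → ℝ) : ∑ i, Φ.mulVec v i = ∑ i, v i := by
  have h1 := Matrix.dotProduct_mulVec (1 : ι → ℝ) Φ v
  rw [← Matrix.mulVec_transpose, h.2] at h1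
  simpa [dotProduct] using h1

namespace CongestionGame

variable {V E W : Type} [Fintype E] [Fintype W] {G : CongestionGame V E W}

lemma WellPosed.isPoisonedEquilibrium {θ : AttackParam E} {d : AttackParam W}
    (h : G.WellPosed θ d) : G.IsPoisonedEquilibrium θ d (G.poisonedFlow θ d) :=
  Classical.epsilon_spec h.1.exists

/-- Both attack matrices preserve total mass, so the poisoned flow is bounded although only its
image under `Φ_θ` is feasible. -/
lemma WellPosed.poisonedFlow_le {θ : AttackParam E} {d : AttackParam W}
    (h : G.WellPosed θ d) (hθ : IsColumnStochastic (attackMatrix θ))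
    (hd : IsColumnStochastic (attackMatrix d)) (e : E) :
    G.poisonedFlow θ d e ≤ Fintype.card E * ∑ w, G.demand w := by
  obtain ⟨μ, hμ⟩ := h.isPoisonedEquilibrium.1
  calc G.poisonedFlow θ d e ≤ ∑ e', G.poisonedFlow θ d e' :=
        Finset.single_le_sum (f := G.poisonedFlow θ d) (fun e' _ => h.2 e') (Finset.mem_univ e)
    _ = ∑ e', (attackMatrix θ).mulVec (G.poisonedFlow θ d) e' := (hθ.sum_mulVec _).symm
    _ ≤ ∑ _e' : E, ∑ w, G.demand w := by
        refine Finset.sum_le_sum fun e' _ => ?_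
        exact (TrafficNetwork.edgeFlow_le_sum_demand hμ e').trans_eq (hd.sum_mulVec _)
    _ = _ := by simp

end CongestionGame

namespace RegularLatency

variable {ℓ : ℝ → ℝ} {l₀ l₁ : ℝ}

lemma second_order_const_nonneg (h : RegularLatency ℓ l₀ l₁) : 0 ≤ l₁ := by
  have := (abs_nonneg _).trans (h.deriv_lipschitz 1 0 zero_le_one le_rfl)
  simpa using this

lemma hasDerivWithinAt (h : RegularLatency ℓ l₀ l₁) {x : ℝ} (hx : 0 ≤ x) :
    HasDerivWithinAt ℓ (derivWithin ℓ (Set.Ici 0) x) (Set.Ici 0) x :=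
  (h.differentiable x hx).hasDerivWithinAt

lemma abs_taylor_le (h : RegularLatency ℓ l₀ l₁) {x y : ℝ} (hx : 0 ≤ x) (hy : 0 ≤ y) :
    |ℓ y - ℓ x - derivWithin ℓ (Set.Ici 0) x * (y - x)| ≤ l₁ * (y - x) ^ 2 := by
  have hsub : Set.uIcc x y ⊆ Set.Ici 0 := fun z hz => (le_min hx hy).trans hz.1
  have hder : ∀ z ∈ Set.uIcc x y,
      HasDerivWithinAt (fun z => ℓ z - derivWithin ℓ (Set.Ici 0) x * z)
        (derivWithin ℓ (Set.Ici 0) z - derivWithin ℓ (Set.Ici 0) x) (Set.uIcc x y) z := by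
    intro z hz
    have h1 := ((h.hasDerivWithinAt (hsub hz)).mono hsub).fun_sub
      ((hasDerivWithinAt_id z (Set.uIcc x y)).const_mul (derivWithin ℓ (Set.Ici 0) x))
    rw [mul_one] at h1
    exact h1
  have hbd : ∀ z ∈ Set.uIcc x y,
      ‖derivWithin ℓ (Set.Ici 0) z - derivWithin ℓ (Set.Ici 0) x‖ ≤ l₁ * |y - x| := by
    intro z hz
    refine (h.deriv_lipschitz z x (hsub hz) hx).trans ?_
    have := h.second_order_const_nonneg
    exact mul_le_mul_of_nonneg_left (Set.abs_sub_left_of_mem_uIcc hz) this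
  have := (convex_uIcc x y).norm_image_sub_le_of_norm_hasDerivWithin_le hder hbd
    Set.left_mem_uIcc Set.right_mem_uIcc
  rw [Real.norm_eq_abs, Real.norm_eq_abs, mul_assoc, ← sq, sq_abs] at this
  convert this using 2
  ring

/-- A crude bound on `ℓ'`, from the increment of `ℓ` over `[x, x + 1]`. -/
lemma abs_derivWithin_le (h : RegularLatency ℓ l₀ l₁) {x : ℝ} (hx : 0 ≤ x) :
    |derivWithin ℓ (Set.Ici 0) x| ≤ l₀ + l₁ := by
  have h1 := h.abs_taylor_le hx (by linarith : 0 ≤ x + 1)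
  have h2 := h.lipschitz (x + 1) x (by linarith) hx
  rw [add_sub_cancel_left] at h1 h2
  rw [mul_one, one_pow, mul_one] at h1
  rw [abs_one, mul_one] at h2
  rw [abs_le] at *
  constructor <;> linarith

lemma le_of_le (h : RegularLatency ℓ l₀ l₁) {c₀ D x : ℝ} (hD : 0 ≤ D) (hc : ℓ D ≤ c₀) (hx : 0 ≤ x) :
    ℓ x ≤ |c₀| + |l₀| * (x + D) := by
  have h1 := (abs_le.1 (h.lipschitz x D hx hD)).2
  have h2 : l₀ * |x - D| ≤ |l₀| * (x + D) := by
    gcongr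
    · exact le_abs_self _
    · rw [abs_le]; constructor <;> linarith
  linarith [le_abs_self c₀]

/-- The derivative of the cost `x * ℓ x` of an edge. -/
noncomputable def _root_.marginalCost (ℓ : ℝ → ℝ) (x : ℝ) : ℝ := ℓ x + x * derivWithin ℓ (Set.Ici 0) x

lemma hasDerivWithinAt_cost (h : RegularLatency ℓ l₀ l₁) {x : ℝ} (hx : 0 ≤ x) :
    HasDerivWithinAt (fun x => x * ℓ x) (marginalCost ℓ x) (Set.Ici 0) x := by
  have := (hasDerivWithinAt_id x (Set.Ici 0)).fun_mul (h.hasDerivWithinAt hx)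
  rw [one_mul] at this
  exact this

lemma abs_cost_taylor_le (h : RegularLatency ℓ l₀ l₁) {x y M : ℝ} (hx : 0 ≤ x) (hxM : x ≤ M)
    (hy : 0 ≤ y) :
    |y * ℓ y - x * ℓ x - marginalCost ℓ x * (y - x)| ≤ (|l₀| + M * |l₁|) * (y - x) ^ 2 := by
  have e : y * ℓ y - x * ℓ x - marginalCost ℓ x * (y - x) = (y - x) * (ℓ y - ℓ x)
      + x * (ℓ y - ℓ x - derivWithin ℓ (Set.Ici 0) x * (y - x)) := by
    unfold marginalCost
    ring
  rw [e]
  refine (abs_add_le _ _).trans ?_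
  rw [abs_mul, abs_mul, abs_of_nonneg hx, add_mul]
  have h1 := h.lipschitz y x hy hx
  have h2 := h.abs_taylor_le hx hy
  have h3 := h.second_order_const_nonneg
  refine add_le_add ?_ ?_
  · calc |y - x| * |ℓ y - ℓ x| ≤ |y - x| * (|l₀| * |y - x|) := by
          gcongr
          exact h1.trans (by gcongr; exact le_abs_self _)
      _ = |l₀| * (y - x) ^ 2 := by rw [← sq_abs (y - x)]; ring
  · calc x * _ ≤ M * (|l₁| * (y - x) ^ 2) := by
          rw [abs_of_nonneg h3]
          gcongr
          exact hx.trans hxM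
      _ = M * |l₁| * (y - x) ^ 2 := by ring

lemma abs_marginalCost_le (h : RegularLatency ℓ l₀ l₁) {c₀ D x M : ℝ} (hD : 0 ≤ D)
    (hc : ℓ D ≤ c₀) (hx : 0 ≤ x) (hxM : x ≤ M) :
    |marginalCost ℓ x| ≤ |c₀| + |l₀| * (M + D) + M * (|l₀| + |l₁|) := by
  unfold marginalCost
  refine (abs_add_le _ _).trans (add_le_add ?_ ?_)
  · rw [abs_of_nonneg (h.nonneg x hx)]
    refine (h.le_of_le hD hc hx).trans ?_
    gcongr
  · rw [abs_mul, abs_of_nonneg hx]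
    have := h.abs_derivWithin_le hx
    gcongr
    · exact hx.trans hxM
    · exact this.trans (add_le_add (le_abs_self _) (le_abs_self _))

end RegularLatency

section RegularGradient

variable {X : Type} [NormedAddCommGroup X] [InnerProductSpace ℝ X] [CompleteSpace X]
  {q : X → ℝ} {x : X} {ρ C₀ C₁ : ℝ}

lemma norm_fderiv_sub_fderiv {f g : X → ℝ} (a b : X) :
    ‖fderiv ℝ f a - fderiv ℝ g b‖ = ‖gradient f a - gradient g b‖ := by
  rw [← toDual_gradient, ← toDual_gradient, ← map_sub, LinearIsometryEquiv.norm_map]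

lemma RegularGradientNear.abs_sub_le (h : RegularGradientNear q x ρ C₀ C₁) {u : X}
    (hu : ‖u‖ < ρ) : |q (x + u) - q x| ≤ |C₀| * ‖u‖ := by
  have := (convex_ball x ρ).norm_image_sub_le_of_norm_fderiv_le (𝕜 := ℝ) (C := |C₀|)
    h.differentiable (fun y hy => by
      rw [← toDual_gradient, LinearIsometryEquiv.norm_map]
      exact (h.bound y hy).trans (le_abs_self _))
    (Metric.mem_ball_self ((norm_nonneg u).trans_lt hu)) (by simpa using hu : x + u ∈ _)
  simpa using this

lemma RegularGradientNear.abs_taylor_le (h : RegularGradientNear q x ρ C₀ C₁) {u : X}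
    (hu : ‖u‖ < ρ) : |q (x + u) - q x - inner ℝ (gradient q x) u| ≤ |C₁| * ‖u‖ ^ 2 := by
  have hx : x ∈ Metric.ball x ρ := Metric.mem_ball_self ((norm_nonneg u).trans_lt hu)
  have hsub : Metric.closedBall x ‖u‖ ⊆ Metric.ball x ρ := Metric.closedBall_subset_ball hu
  have := (convex_closedBall x ‖u‖).norm_image_sub_le_of_norm_fderiv_le' (𝕜 := ℝ)
    (C := |C₁| * ‖u‖) (φ := fderiv ℝ q x)
    (fun y hy => h.differentiable y (hsub hy)) (fun y hy => by
      rw [norm_fderiv_sub_fderiv]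
      refine (h.lipschitz y (hsub hy) x hx).trans ?_
      gcongr
      · exact le_abs_self _
      · rwa [← dist_eq_norm])
    (Metric.mem_closedBall_self (norm_nonneg u)) (by simp : x + u ∈ _)
  rw [add_sub_cancel_left, ← inner_gradient_left] at this
  rw [sq, ← mul_assoc]
  exact this

end RegularGradient

/-! ### First-order expansion of the attack utility -/

/-- The parameter `vec I` of the identity matrix. -/
noncomputable def identityParam (ι : Type) [DecidableEq ι] : AttackParam ι :=
  WithLp.toLp 2 fun p => (1 : Matrix ι ι ℝ) p.1 p.2

lemma frobeniusSq_attackMatrix_sub_one {ι : Type} [Fintype ι] [DecidableEq ι] (θ : AttackParam ι) :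
    frobeniusSq (attackMatrix θ - 1) = ‖θ - identityParam ι‖ ^ 2 := by
  rw [EuclideanSpace.norm_sq_eq, Fintype.sum_prod_type]
  simp [frobeniusSq, attackMatrix, identityParam, sq_abs]

lemma IsColumnStochastic.le_one {ι : Type} [Fintype ι] {Φ : Matrix ι ι ℝ}
    (h : IsColumnStochastic Φ) (i j : ι) : Φ i j ≤ 1 := by
  have hsum : ∑ i, Φ i j = 1 := by
    have := congrFun h.2 j
    simpa [Matrix.mulVec, dotProduct] using this
  rw [← hsum]
  exact Finset.single_le_sum (f := fun i => Φ i j) (fun i _ => h.1 i j) (Finset.mem_univ i)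

lemma finrank_attackParam (ι : Type) [Fintype ι] :
    Module.finrank ℝ (AttackParam ι) = Fintype.card ι * Fintype.card ι := by
  rw [finrank_euclideanSpace, Fintype.card_prod]

lemma IsColumnStochastic.norm_sub_identityParam_sq_le {ι : Type} [Fintype ι] [DecidableEq ι]
    {θ : AttackParam ι} (h : IsColumnStochastic (attackMatrix θ)) :
    ‖θ - identityParam ι‖ ^ 2 ≤ Module.finrank ℝ (AttackParam ι) := by
  rw [← frobeniusSq_attackMatrix_sub_one, finrank_attackParam, frobeniusSq]
  calc ∑ i, ∑ j, (attackMatrix θ - 1) i j ^ 2 ≤ ∑ _i : ι, ∑ _j : ι, (1 : ℝ) := by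
        refine Finset.sum_le_sum fun i _ => Finset.sum_le_sum fun j _ => ?_
        have h0 := h.1 i j
        have h1 := h.le_one i j
        rw [sq_le_one_iff_abs_le_one, Matrix.sub_apply, Matrix.one_apply, abs_le]
        split_ifs <;> constructor <;> linarith
    _ = _ := by simp

lemma hasGradientAt_half_norm_sub_sq {X : Type} [NormedAddCommGroup X] [InnerProductSpace ℝ X]
    [CompleteSpace X] (J y : X) :
    HasGradientAt (fun y => 1 / 2 * ‖y - J‖ ^ 2) (y - J) y := by
  rw [hasGradientAt_iff_hasFDerivAt]
  have h := (((hasFDerivAt_id y).sub_const J).norm_sq).const_mul (1 / 2 : ℝ)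
  refine h.congr_fderiv ?_
  ext v
  simp

namespace CongestionGame

variable {V E W X : Type} [Fintype E] {G : CongestionGame V E W} [NormedAddCommGroup X]
  [InnerProductSpace ℝ X] [CompleteSpace X] {q : X → E → ℝ} {x : X} {ρ l₀ l₁ C₀ C₁ : ℝ}

/-- The gradient, by the chain rule, of the aggregated latency of a parameterized edge flow `q`. -/
noncomputable def latencyGradient (G : CongestionGame V E W) (q : X → E → ℝ) (y : X) : X :=
  ∑ e, marginalCost (G.latency e) (q y e) • gradient (fun z => q z e) y

/-- Where an edge flow vanishes, the latency has only a one-sided derivative; the chain rule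
survives because `q` maps a neighbourhood of `y` into `[0, ∞)`. -/
lemma hasGradientAt_aggregatedLatency (hreg : ∀ e, RegularLatency (G.latency e) l₀ l₁)
    (hq : ∀ y ∈ Metric.ball x ρ, ∀ e, 0 ≤ q y e)
    (hgrad : ∀ e, RegularGradientNear (fun y => q y e) x ρ C₀ C₁) {y : X}
    (hy : y ∈ Metric.ball x ρ) :
    HasGradientAt (fun y => G.aggregatedLatency (q y)) (G.latencyGradient q y) y := by
  rw [hasGradientAt_iff_hasFDerivAt]
  have hball : Metric.ball x ρ ∈ nhds y := Metric.isOpen_ball.mem_nhds hy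
  have h : ∀ e ∈ (Finset.univ : Finset E), HasFDerivAt (fun y => q y e * G.latency e (q y e))
      (marginalCost (G.latency e) (q y e) • fderiv ℝ (fun z => q z e) y) y := fun e _ =>
    (HasDerivWithinAt.comp_hasFDerivWithinAt (t := Set.Ici (0 : ℝ)) y
      ((hreg e).hasDerivWithinAt_cost (hq y hy e))
      ((hgrad e).differentiable y hy).hasFDerivAt.hasFDerivWithinAt
      (fun z hz => hq z hz e)).hasFDerivAt hball
  have hsum := HasFDerivAt.fun_sum h
  refine hsum.congr_fderiv ?_
  ext v
  simp [latencyGradient]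

lemma abs_aggregatedLatency_taylor_le (hreg : ∀ e, RegularLatency (G.latency e) l₀ l₁)
    (hq : ∀ y ∈ Metric.ball x ρ, ∀ e, 0 ≤ q y e)
    (hgrad : ∀ e, RegularGradientNear (fun y => q y e) x ρ C₀ C₁) {c₀ D M : ℝ} (hD : 0 ≤ D)
    (hc : ∀ e, G.latency e D ≤ c₀) (hM : ∀ e, q x e ≤ M) {u : X} (hu : ‖u‖ < ρ) :
    |G.aggregatedLatency (q (x + u)) - G.aggregatedLatency (q x) - inner ℝ (G.latencyGradient q x) u|
      ≤ Fintype.card E * ((|c₀| + |l₀| * (M + D) + M * (|l₀| + |l₁|)) * |C₁|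
        + (|l₀| + M * |l₁|) * C₀ ^ 2) * ‖u‖ ^ 2 := by
  have hx : x ∈ Metric.ball x ρ := Metric.mem_ball_self ((norm_nonneg u).trans_lt hu)
  have hxu : x + u ∈ Metric.ball x ρ := by simpa using hu
  simp only [aggregatedLatency, latencyGradient, sum_inner, real_inner_smul_left,
    ← Finset.sum_sub_distrib]
  refine (Finset.abs_sum_le_sum_abs _ _).trans ?_
  rw [mul_assoc, ← nsmul_eq_mul, ← Finset.card_univ]
  refine Finset.sum_le_card_nsmul _ _ _ fun e _ => ?_
  have h1 := (hreg e).abs_cost_taylor_le (hq x hx e) (hM e) (hq _ hxu e)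
  have h2 := (hreg e).abs_marginalCost_le hD (hc e) (hq x hx e) (hM e)
  have h3 := (hgrad e).abs_sub_le hu
  have h4 := (hgrad e).abs_taylor_le hu
  have hM0 : 0 ≤ M := (hq x hx e).trans (hM e)
  set a := marginalCost (G.latency e) (q x e)
  have e1 : q (x + u) e * G.latency e (q (x + u) e) - q x e * G.latency e (q x e)
        - a * inner ℝ (gradient (fun z => q z e) x) u
      = (q (x + u) e * G.latency e (q (x + u) e) - q x e * G.latency e (q x e)
          - a * (q (x + u) e - q x e))
        + a * (q (x + u) e - q x e - inner ℝ (gradient (fun z => q z e) x) u) := by ring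
  rw [e1]
  refine (abs_add_le _ _).trans ?_
  rw [abs_mul, add_mul, add_comm]
  refine add_le_add ?_ (h1.trans ?_)
  · rw [mul_assoc]
    exact mul_le_mul h2 h4 (abs_nonneg _) ((abs_nonneg _).trans h2)
  · rw [mul_assoc]
    gcongr
    rw [← sq_abs, ← sq_abs C₀, ← mul_pow]
    gcongr

lemma abs_aggregatedLatency_le (hreg : ∀ e, RegularLatency (G.latency e) l₀ l₁)
    (hq : ∀ y ∈ Metric.ball x ρ, ∀ e, 0 ≤ q y e)
    (hgrad : ∀ e, RegularGradientNear (fun y => q y e) x ρ C₀ C₁) {c₀ D M : ℝ} (hD : 0 ≤ D)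
    (hc : ∀ e, G.latency e D ≤ c₀) (hM : ∀ e, q x e ≤ M) {u : X} (hu : ‖u‖ < ρ) :
    |G.aggregatedLatency (q (x + u))|
      ≤ Fintype.card E * ((M + |C₀| * ρ) * (|c₀| + |l₀| * ((M + |C₀| * ρ) + D))) := by
  have hx : x ∈ Metric.ball x ρ := Metric.mem_ball_self ((norm_nonneg u).trans_lt hu)
  have hxu : x + u ∈ Metric.ball x ρ := by simpa using hu
  refine (Finset.abs_sum_le_sum_abs _ _).trans ?_
  rw [← nsmul_eq_mul, ← Finset.card_univ]
  refine Finset.sum_le_card_nsmul _ _ _ fun e _ => ?_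
  have h0 := hq _ hxu e
  have h1 : q (x + u) e ≤ M + |C₀| * ρ := by
    have h2 := (abs_le.1 ((hgrad e).abs_sub_le hu)).2
    have h3 : |C₀| * ‖u‖ ≤ |C₀| * ρ := by gcongr
    linarith [hM e]
  rw [abs_mul, abs_of_nonneg h0, abs_of_nonneg ((hreg e).nonneg _ h0)]
  refine mul_le_mul h1 (((hreg e).le_of_le hD (hc e) h0).trans ?_) ((hreg e).nonneg _ h0)
    (h0.trans h1)
  gcongr

/-- The attack utility as a function of one of the two parameters has, with constants polynomial in
the size `N` of the problem, a bound and a first-order expansion around the base point. Here `X` is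
the space of this parameter, `J` the identity, `x` the base point and `κ` the penalty of the other
parameter. -/
lemma exists_uniform_expansion (γ s D c₀ l₀ l₁ C₀ C₁ r₀ : ℝ) (hs : 0 < s) (hr₀ : 0 < r₀)
    (hD : 0 ≤ D) :
    ∃ k β : ℝ, 0 ≤ k ∧ 0 < β ∧ ∀ (V E W X : Type) [Fintype E] [Fintype W] [NormedAddCommGroup X]
      [InnerProductSpace ℝ X] [CompleteSpace X] (G : CongestionGame V E W) (q : X → E → ℝ) (x J : X)
      (κ N : ℝ), (∀ e, RegularLatency (G.latency e) l₀ l₁) → (∀ e, G.latency e D ≤ c₀) →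
      s ≤ G.optimalLatency → (∀ y ∈ Metric.ball x r₀, ∀ e, 0 ≤ q y e) →
      (∀ e, RegularGradientNear (fun y => q y e) x r₀ C₀ C₁) → (∀ e, q x e ≤ N * D) → 1 ≤ N →
      Fintype.card E ≤ N → ‖x - J‖ ^ 2 ≤ N → 0 ≤ κ → κ ≤ N → ∀ f : X → ℝ,
      (∀ y, f y = 1 / 2 * (‖y - J‖ ^ 2 + κ)
        - γ * (G.aggregatedLatency (q y) / G.optimalLatency)) →
      (∀ y ∈ Metric.ball x r₀, DifferentiableAt ℝ f y) ∧
      ∀ u, ‖u‖ < r₀ → |f (x + u)| ≤ β * N ^ 3 ∧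
        |f (x + u) - f x - inner ℝ (gradient f x) u| ≤ k * N ^ 2 * ‖u‖ ^ 2 := by
  set a := (|c₀| + D * (3 * |l₀| + |l₁|)) * |C₁| + (|l₀| + D * |l₁|) * C₀ ^ 2 with ha
  set y₀ := D + |C₀| * r₀ with hy₀
  set b := y₀ * (|c₀| + |l₀| * (y₀ + D)) with hb
  have ha0 : 0 ≤ a := by positivity
  have hy0 : 0 ≤ y₀ := by positivity
  have hb0 : 0 ≤ b := by positivity
  refine ⟨1 / 2 + |γ| / s * a, 2 + r₀ ^ 2 + |γ| / s * b, by positivity, by positivity, ?_⟩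
  intro V E W X _ _ _ _ _ G q x J κ N hreg hc hopt hq hgrad hM hN hcard hJ hκ0 hκ f hf
  have hS : 0 < G.optimalLatency := hs.trans_le hopt
  have hη : |γ / G.optimalLatency| ≤ |γ| / s := by
    rw [abs_div, abs_of_pos hS]
    gcongr
  have hN0 : 0 ≤ N := zero_le_one.trans hN
  set η := γ / G.optimalLatency with hηdef
  have hf' : f = fun y => 1 / 2 * ‖y - J‖ ^ 2 + 1 / 2 * κ - η * G.aggregatedLatency (q y) := by
    funext y
    rw [hf, hηdef]
    ring
  have hder : ∀ y ∈ Metric.ball x r₀, HasGradientAt f (y - J - η • G.latencyGradient q y) y := by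
    intro y hy
    have h1 := hasGradientAt_iff_hasFDerivAt.1 (hasGradientAt_half_norm_sub_sq J y)
    have h2 := hasGradientAt_iff_hasFDerivAt.1 (hasGradientAt_aggregatedLatency hreg hq hgrad hy)
    rw [hasGradientAt_iff_hasFDerivAt, hf']
    refine ((h1.add_const (1 / 2 * κ)).fun_sub (h2.const_mul η)).congr_fderiv ?_
    simp
  refine ⟨fun y hy => (hder y hy).differentiableAt, fun u hu => ?_⟩
  have hx : x ∈ Metric.ball x r₀ := Metric.mem_ball_self hr₀
  have hsq : ‖x + u - J‖ ^ 2 = ‖x - J‖ ^ 2 + 2 * inner ℝ (x - J) u + ‖u‖ ^ 2 := by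
    rw [add_sub_right_comm, norm_add_sq_real]
  have hN2 : N ≤ N ^ 2 := le_self_pow₀ hN two_ne_zero
  have hN3 : N ≤ N ^ 3 := le_self_pow₀ hN three_ne_zero
  constructor
  · have h1 : |G.aggregatedLatency (q (x + u))| ≤ N ^ 3 * b := by
      refine (abs_aggregatedLatency_le hreg hq hgrad hD hc hM hu).trans ?_
      have hY : N * D + |C₀| * r₀ ≤ N * y₀ := by
        have : |C₀| * r₀ ≤ N * (|C₀| * r₀) := le_mul_of_one_le_left (by positivity) hN
        rw [hy₀]
        linarith
      have hZ : |c₀| + |l₀| * (N * y₀ + D) ≤ N * (|c₀| + |l₀| * (y₀ + D)) := by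
        have h1 : |c₀| ≤ N * |c₀| := le_mul_of_one_le_left (by positivity) hN
        have h2 : |l₀| * D ≤ N * (|l₀| * D) := le_mul_of_one_le_left (by positivity) hN
        linarith
      calc Fintype.card E * ((N * D + |C₀| * r₀) * (|c₀| + |l₀| * (N * D + |C₀| * r₀ + D)))
          ≤ N * ((N * y₀) * (|c₀| + |l₀| * (N * y₀ + D))) := by gcongr
        _ ≤ N * ((N * y₀) * (N * (|c₀| + |l₀| * (y₀ + D)))) := by gcongr
        _ = N ^ 3 * b := by rw [hb]; ring
    have h2 : ‖x + u - J‖ ^ 2 ≤ 2 * N + 2 * r₀ ^ 2 := by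
      have h3 := parallelogram_law_with_norm ℝ (x - J) u
      rw [← add_sub_right_comm] at h3
      have h4 : ‖u‖ ^ 2 ≤ r₀ ^ 2 := by gcongr
      nlinarith [sq_nonneg ‖x - J - u‖]
    have h5 : |η * G.aggregatedLatency (q (x + u))| ≤ |γ| / s * (N ^ 3 * b) := by
      rw [abs_mul]
      gcongr
    have h6 : r₀ ^ 2 ≤ r₀ ^ 2 * N ^ 3 := le_mul_of_one_le_right (by positivity) (hN.trans hN3)
    rw [hf']
    refine (abs_sub _ _).trans ?_
    rw [abs_of_nonneg (by positivity : 0 ≤ 1 / 2 * ‖x + u - J‖ ^ 2 + 1 / 2 * κ)]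
    nlinarith
  · have h1 := abs_aggregatedLatency_taylor_le hreg hq hgrad hD hc hM hu
    set T := G.aggregatedLatency (q (x + u)) - G.aggregatedLatency (q x)
      - inner ℝ (G.latencyGradient q x) u with hT
    have h2 : |T| ≤ N ^ 2 * a * ‖u‖ ^ 2 := by
      refine h1.trans ?_
      have hA : |c₀| + |l₀| * (N * D + D) + N * D * (|l₀| + |l₁|)
          ≤ N * (|c₀| + D * (3 * |l₀| + |l₁|)) := by
        have h1 : |c₀| ≤ N * |c₀| := le_mul_of_one_le_left (by positivity) hN
        have h2 : |l₀| * D ≤ N * (|l₀| * D) := le_mul_of_one_le_left (by positivity) hN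
        linarith
      have hB : |l₀| + N * D * |l₁| ≤ N * (|l₀| + D * |l₁|) := by
        have h1 : |l₀| ≤ N * |l₀| := le_mul_of_one_le_left (by positivity) hN
        linarith
      calc _ ≤ N * (N * (|c₀| + D * (3 * |l₀| + |l₁|)) * |C₁|
            + N * (|l₀| + D * |l₁|) * C₀ ^ 2) * ‖u‖ ^ 2 := by gcongr
        _ = _ := by rw [ha]; ring
    have e : f (x + u) - f x - inner ℝ (gradient f x) u = 1 / 2 * ‖u‖ ^ 2 - η * T := by
      rw [(hder x hx).gradient, hf', inner_sub_left, real_inner_smul_left, hT]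
      simp only []
      rw [hsq]
      ring
    have h5 : |η * T| ≤ |γ| / s * (N ^ 2 * a * ‖u‖ ^ 2) := by
      rw [abs_mul]
      gcongr
    have h6 : ‖u‖ ^ 2 ≤ N ^ 2 * ‖u‖ ^ 2 :=
      le_mul_of_one_le_left (by positivity) (hN.trans hN2)
    rw [e]
    refine (abs_sub _ _).trans ?_
    rw [abs_of_nonneg (by positivity : 0 ≤ 1 / 2 * ‖u‖ ^ 2)]
    linarith

end CongestionGame

/-! ### Sample complexity -/

/-- The radius and sample size below make the failure probability of the estimate in `X`
superexponentially small in a size `N` that dominates the dimension. -/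
lemma measureReal_onePointEstimate_le_exp {X : Type} [NormedAddCommGroup X] [InnerProductSpace ℝ X]
    [FiniteDimensional ℝ X] [MeasurableSpace X] [BorelSpace X] {f : X → ℝ} {x : X}
    {r r₀ k β N ε : ℝ} (hr : 0 < r) (hr₀ : r < r₀) (hε : 0 < ε) (hk : 0 ≤ k) (hβ : 0 < β)
    (hN : 1 ≤ N) (hdim : Module.finrank ℝ X ≤ N)
    (hdiff : ∀ y ∈ Metric.ball x r₀, DifferentiableAt ℝ f y)
    (hexp : ∀ u, ‖u‖ < r₀ → |f (x + u)| ≤ β * N ^ 3 ∧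
        |f (x + u) - f x - inner ℝ (gradient f x) u| ≤ k * N ^ 2 * ‖u‖ ^ 2)
    (hbias : 2 * k * N ^ 4 * r ≤ ε) {m : ℕ}
    (hm : 8 * β ^ 2 * N ^ 10 * (1 / ε) ^ 2 * (1 / r) ^ 2 * (4 * N + N ^ 2 * (1 / ε)) + 1 ≤ m)
    {Ω : Type} [MeasurableSpace Ω] {P : Measure Ω} [IsProbabilityMeasure P] {u : Fin m → Ω → X}
    (hind : iIndepFun u P) (hlaw : ∀ i, HasLaw (u i) (uniformSphere X r) P) :
    P.real {ω | ε < ‖onePointEstimate f x r (fun i => u i ω) - gradient f x‖}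
      ≤ 2 * N * Real.exp (-(4 * N + N ^ 2 * (1 / ε))) := by
  set n := Module.finrank ℝ X
  have hN0 : 0 < N := zero_lt_one.trans_le hN
  have hm0 : 0 < m := by
    have : (0 : ℝ) < m := lt_of_lt_of_le (by positivity) hm
    exact_mod_cast this
  have hcont : ContinuousOn (fun u => f (x + u)) (Metric.sphere 0 r) := fun u hu => by
    have hu' : x + u ∈ Metric.ball x r₀ := by
      have : ‖u‖ = r := by simpa using hu
      simpa [this] using hr₀
    exact (ContinuousAt.comp (f := fun u => x + u) (g := f) (hdiff _ hu').continuousAt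
      (by fun_prop)).continuousWithinAt
  refine (measureReal_onePointEstimate_le (B := β * N ^ 3) (K := k * N ^ 2) hr hε hcont
    (fun v hv => (hexp v (hv.trans_lt hr₀)).1)
    (fun v hv => by simpa [hv] using (hexp v (hv.trans_lt hr₀)).2) ?_ hm0 hind hlaw).trans ?_
  · calc 2 * (n : ℝ) ^ 2 * (k * N ^ 2) * r ≤ 2 * N ^ 2 * (k * N ^ 2) * r := by gcongr
      _ = 2 * k * N ^ 4 * r := by ring
      _ ≤ ε := hbias
  -- In dimension zero the exponent is a division by zero, but the prefactor vanishes.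
  · rcases Nat.eq_zero_or_pos n with hn | hn
    · change 2 * ((n : ℕ) : ℝ) * _ ≤ _
      rw [hn]
      simp only [Nat.cast_zero, mul_zero, zero_mul]
      positivity
    · have hn' : (0 : ℝ) < n := by exact_mod_cast hn
      have key : 4 * N + N ^ 2 * (1 / ε)
          ≤ m * ε ^ 2 * r ^ 2 / (8 * n ^ 4 * (β * N ^ 3) ^ 2) := by
        rw [le_div_iff₀ (by positivity)]
        calc (4 * N + N ^ 2 * (1 / ε)) * (8 * n ^ 4 * (β * N ^ 3) ^ 2)
            ≤ (4 * N + N ^ 2 * (1 / ε)) * (8 * N ^ 4 * (β * N ^ 3) ^ 2) := by gcongr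
          _ = (8 * β ^ 2 * N ^ 10 * (1 / ε) ^ 2 * (1 / r) ^ 2 * (4 * N + N ^ 2 * (1 / ε)))
              * (ε ^ 2 * r ^ 2) := by
            field_simp
          _ ≤ m * (ε ^ 2 * r ^ 2) := by
            gcongr
            linarith
          _ = m * ε ^ 2 * r ^ 2 := by ring
      gcongr

/-- The demanded failure probability `(n / ε) ^ (-n)` is only exponentially small in a polynomial of
`N` and `1 / ε`, hence attained with polynomially many samples. -/
lemma exp_tail_le {N ε : ℝ} {n : ℕ} (hN : 1 ≤ N) (hn : n ≤ N) (hε : 0 < ε) :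
    4 * N * Real.exp (-(4 * N + N ^ 2 * (1 / ε))) ≤ ((n : ℝ) / ε) ^ (-(n : ℤ)) := by
  have hN0 : 0 < N := zero_lt_one.trans_le hN
  have hpos : 0 < ((n : ℝ) / ε) ^ n := by
    rcases Nat.eq_zero_or_pos n with h | h
    · simp [h]
    · have : (0 : ℝ) < n := by exact_mod_cast h
      positivity
  -- The logarithm of `(n / ε) ^ n` is at most `n * (n / ε)`, which is polynomial.
  have h1 : ((n : ℝ) / ε) ^ n ≤ Real.exp (N ^ 2 * (1 / ε)) := by
    calc ((n : ℝ) / ε) ^ n ≤ Real.exp (n / ε) ^ n := by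
          gcongr
          linarith [Real.add_one_le_exp ((n : ℝ) / ε)]
      _ = Real.exp ((n : ℝ) ^ 2 * (1 / ε)) := by
          rw [← Real.exp_nat_mul]
          ring_nf
      _ ≤ _ := by gcongr
  have h2 : 4 * N ≤ Real.exp (4 * N) := by linarith [Real.add_one_le_exp (4 * N)]
  rw [zpow_neg, zpow_natCast, neg_add, Real.exp_add]
  calc 4 * N * (Real.exp (-(4 * N)) * Real.exp (-(N ^ 2 * (1 / ε))))
      ≤ Real.exp (4 * N) * (Real.exp (-(4 * N)) * Real.exp (-(N ^ 2 * (1 / ε)))) := by gcongr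
    _ = (Real.exp (N ^ 2 * (1 / ε)))⁻¹ := by
        rw [← mul_assoc, ← Real.exp_add, add_neg_cancel, Real.exp_zero, one_mul, Real.exp_neg]
    _ ≤ _ := inv_anti₀ hpos h1

/-- No measurability of `A` and `B` is needed. -/
lemma one_sub_le_measureReal_of_compl {Ω : Type} [MeasurableSpace Ω] {P : Measure Ω}
    [IsProbabilityMeasure P] {A B : Ω → Prop} {δ : ℝ} (hA : P.real {ω | ¬A ω} ≤ δ / 2)
    (hB : P.real {ω | ¬B ω} ≤ δ / 2) : 1 - δ ≤ P.real {ω | A ω ∧ B ω} := by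
  have h : (1 : ℝ) ≤ P.real {ω | A ω ∧ B ω} + (P.real {ω | ¬A ω} + P.real {ω | ¬B ω}) := by
    calc (1 : ℝ) = P.real Set.univ := probReal_univ.symm
      _ ≤ P.real ({ω | A ω ∧ B ω} ∪ ({ω | ¬A ω} ∪ {ω | ¬B ω})) := by
          refine measureReal_mono fun ω _ => ?_
          simp only [Set.mem_union, Set.mem_ofPred_eq]
          tauto
      _ ≤ _ := (measureReal_union_le _ _).trans (add_le_add le_rfl (measureReal_union_le _ _))
  linarith

namespace CongestionGame

lemma one_le_card_of_optimalLatency_pos {V E W : Type} [Fintype E] {G : CongestionGame V E W}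
    (h : 0 < G.optimalLatency) : 1 ≤ Fintype.card E := by
  by_contra hE
  have : IsEmpty E := Fintype.card_eq_zero_iff.1 (by omega)
  simp [optimalLatency, aggregatedLatency] at h

variable {V E W : Type} [Fintype E] [Fintype W] {G : CongestionGame V E W}

open Classical in
lemma attackUtility_eq (γ : ℝ) (θ : AttackParam E) (d : AttackParam W) :
    G.attackUtility γ θ d = 1 / 2 * (‖θ - identityParam E‖ ^ 2 + ‖d - identityParam W‖ ^ 2)
      - γ * (G.aggregatedLatency (G.poisonedFlow θ d) / G.optimalLatency) := by
  rw [← frobeniusSq_attackMatrix_sub_one, ← frobeniusSq_attackMatrix_sub_one]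
  rfl

end CongestionGame

theorem mainTheorem6 (γ s D c₀ l₀ l₁ C₀ C₁ r₀ : ℝ) (hs : 0 < s) (hr₀ : 0 < r₀) :
    ∃ (hRadius : MvPolynomial (Fin 2) ℝ) (hSample : MvPolynomial (Fin 3) ℝ)
      (hSample' : MvPolynomial (Fin 2) ℝ),
      (∀ (n : ℕ) (ε : ℝ), 0 < ε → 0 < MvPolynomial.eval ![(n : ℝ), 1 / ε] hRadius) ∧
      ∀ (V E W : Type) [Finite V] [Fintype E] [Fintype W] (G : CongestionGame V E W)
        (θ : AttackParam E) (d : AttackParam W),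
        (∀ e, RegularLatency (G.latency e) l₀ l₁) →
        (∀ e, G.latency e D ≤ c₀) →
        ∑ w, G.demand w ≤ D →
        s ≤ G.optimalLatency →
        IsColumnStochastic (attackMatrix θ) →
        IsColumnStochastic (attackMatrix d) →
        G.RegularEquilibriumNear θ d r₀ C₀ C₁ →
        DifferentiableAt ℝ (fun θ' => G.attackUtility γ θ' d) θ ∧
        DifferentiableAt ℝ (fun d' => G.attackUtility γ θ d') d ∧
        ∀ (dimΘ dimD : ℕ), dimΘ = Module.finrank ℝ (AttackParam E) →
          dimD = Module.finrank ℝ (AttackParam W) →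
          ∀ (ε ρ : ℝ), 0 < ε →
            ρ = 1 / max (MvPolynomial.eval ![(dimΘ : ℝ), 1 / ε] hRadius)
              (MvPolynomial.eval ![(dimD : ℝ), 1 / ε] hRadius) →
            (∀ (r : ℝ) (m : ℕ), 0 < r → r ≤ ρ →
              max (MvPolynomial.eval ![(dimΘ : ℝ), 1 / ε, 1 / r] hSample)
                (MvPolynomial.eval ![(dimD : ℝ), 1 / ε, 1 / r] hSample) ≤ m →
              G.EstimatesGradients γ θ d ε r m) ∧
            (∀ m : ℕ,
              max (MvPolynomial.eval ![(dimΘ : ℝ), 1 / ε] hSample')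
                (MvPolynomial.eval ![(dimD : ℝ), 1 / ε] hSample') ≤ m →
              G.EstimatesGradients γ θ d ε ρ m) := by
  -- A negative `D` admits no game at all; `max D 0` gives nonnegative constants in every case.
  obtain ⟨k, β, hk, hβ, hexp⟩ := CongestionGame.exists_uniform_expansion γ s (max D 0) c₀ l₀ l₁
    C₀ C₁ r₀ hs hr₀ (le_max_right _ _)
  -- The first summand keeps the sphere of radius `r` inside the ball of radius `r₀`, the second one
  -- bounds the bias.
  let hRad : ℝ → ℝ → ℝ := fun n x => 2 / r₀ + 2 * k * n ^ 4 * x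
  -- The Hoeffding exponent is at least `4 n + n² / ε` for this many samples; the summand `1` excludes
  -- an empty sample.
  let hSam : ℝ → ℝ → ℝ → ℝ := fun n x y =>
    8 * β ^ 2 * n ^ 10 * x ^ 2 * y ^ 2 * (4 * n + n ^ 2 * x) + 1
  open MvPolynomial in
  have hpoly : ∃ (p : MvPolynomial (Fin 2) ℝ) (p₃ : MvPolynomial (Fin 3) ℝ)
      (p' : MvPolynomial (Fin 2) ℝ),
      (∀ n x : ℝ, eval ![n, x] p = hRad n x) ∧ (∀ n x y : ℝ, eval ![n, x, y] p₃ = hSam n x y) ∧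
        ∀ n x : ℝ, eval ![n, x] p' = hSam n x (hRad n x) := by
    refine ⟨C (2 / r₀) + C (2 * k) * X 0 ^ 4 * X 1,
      C (8 * β ^ 2) * X 0 ^ 10 * X 1 ^ 2 * X 2 ^ 2 * (C 4 * X 0 + X 0 ^ 2 * X 1) + C 1,
      C (8 * β ^ 2) * X 0 ^ 10 * X 1 ^ 2 * (C (2 / r₀) + C (2 * k) * X 0 ^ 4 * X 1) ^ 2
        * (C 4 * X 0 + X 0 ^ 2 * X 1) + C 1, ?_, ?_, ?_⟩
    · intro n x
      simp only [map_add, map_mul, map_pow, eval_C, eval_X, hRad]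
      rfl
    · intro n x y
      simp only [map_add, map_mul, map_pow, eval_C, eval_X, hSam]
      rfl
    · intro n x
      simp only [map_add, map_mul, map_pow, eval_C, eval_X, hSam, hRad]
      rfl
  obtain ⟨p, p₃, p', hp, hp₃, hp'⟩ := hpoly
  refine ⟨p, p₃, p', fun n ε hε => ?_, ?_⟩
  · rw [hp]
    positivity
  intro V E W _ _ _ G θ d hreg hc hdem hopt hθ hd hnear
  classical
  have hD : 0 ≤ D := (Finset.sum_nonneg fun w _ => G.demand_nonneg w).trans hdem
  rw [max_eq_left hD] at hexp
  set dimΘ := Module.finrank ℝ (AttackParam E) with hdimΘ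
  set dimD := Module.finrank ℝ (AttackParam W) with hdimD
  set N : ℝ := max (dimΘ : ℝ) dimD with hN
  have hcardE := CongestionGame.one_le_card_of_optimalLatency_pos (hs.trans_le hopt)
  have hcardΘ : Fintype.card E ≤ dimΘ := by
    rw [hdimΘ, finrank_attackParam]
    exact Nat.le_mul_self _
  have hcardN : (Fintype.card E : ℝ) ≤ N := le_max_of_le_left (by exact_mod_cast hcardΘ)
  have hN1 : 1 ≤ N := le_trans (by exact_mod_cast hcardE) hcardN
  have hN0 : 0 ≤ N := zero_le_one.trans hN1
  have hflow : ∀ e, G.poisonedFlow θ d e ≤ N * D := fun e =>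
    ((hnear.wellPosed_left θ (Metric.mem_ball_self hr₀)).poisonedFlow_le hθ hd e).trans
      (mul_le_mul hcardN hdem (Finset.sum_nonneg fun w _ => G.demand_nonneg w) hN0)
  have hJθ : ‖θ - identityParam E‖ ^ 2 ≤ N :=
    hθ.norm_sub_identityParam_sq_le.trans (le_max_left _ _)
  have hJd : ‖d - identityParam W‖ ^ 2 ≤ N :=
    hd.norm_sub_identityParam_sq_le.trans (le_max_right _ _)
  obtain ⟨hdiffθ, hexpθ⟩ := hexp V E W (AttackParam E) G (fun θ' => G.poisonedFlow θ' d) θ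
    (identityParam E) (‖d - identityParam W‖ ^ 2) N hreg hc hopt
    (fun y hy => (hnear.wellPosed_left y hy).2) hnear.gradient_left hflow hN1 hcardN hJθ
    (by positivity) hJd (fun θ' => G.attackUtility γ θ' d) (fun θ' => G.attackUtility_eq γ θ' d)
  obtain ⟨hdiffd, hexpd⟩ := hexp V E W (AttackParam W) G (fun d' => G.poisonedFlow θ d') d
    (identityParam W) (‖θ - identityParam E‖ ^ 2) N hreg hc hopt
    (fun y hy => (hnear.wellPosed_right y hy).2) hnear.gradient_right hflow hN1 hcardN hJd
    (by positivity) hJθ (fun d' => G.attackUtility γ θ d') (fun d' => by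
      rw [G.attackUtility_eq γ θ d', add_comm (‖θ - identityParam E‖ ^ 2)])
  refine ⟨hdiffθ θ (Metric.mem_ball_self hr₀), hdiffd d (Metric.mem_ball_self hr₀), ?_⟩
  rintro _ _ rfl rfl ε ρ hε hρ
  have hRadpos : 0 < hRad N (1 / ε) := by positivity
  have hmain : ∀ (r : ℝ) (m : ℕ), 0 < r → r ≤ 1 / hRad N (1 / ε) → hSam N (1 / ε) (1 / r) ≤ m →
      G.EstimatesGradients γ θ d ε r m := by
    intro r m hr hrle hm
    rw [le_div_iff₀ hRadpos] at hrle
    have hsplit : r * (2 / r₀) + r * (2 * k * N ^ 4 * (1 / ε)) ≤ 1 := by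
      rw [← mul_add]; exact hrle
    have hrr₀ : r < r₀ := by
      have h1 : r * (2 / r₀) ≤ 1 := by
        have : 0 ≤ r * (2 * k * N ^ 4 * (1 / ε)) := by positivity
        linarith
      rw [← mul_div_assoc, div_le_one hr₀] at h1
      linarith
    have hbias : 2 * k * N ^ 4 * r ≤ ε := by
      have h1 : r * (2 * k * N ^ 4 * (1 / ε)) ≤ 1 := by
        have : 0 ≤ r * (2 / r₀) := by positivity
        linarith
      have h2 : r * (2 * k * N ^ 4 * (1 / ε)) = 2 * k * N ^ 4 * r / ε := by ring
      rwa [h2, div_le_one hε] at h1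
    intro Ω _ P _ u v hu hulaw hv hvlaw n hn
    have hnN : (n : ℝ) ≤ N := by
      rcases hn with rfl | rfl
      · exact le_max_left _ _
      · exact le_max_right _ _
    have hfu := measureReal_onePointEstimate_le_exp hr hrr₀ hε hk hβ hN1
      (le_max_left _ _) hdiffθ hexpθ hbias hm hu hulaw
    have hfv := measureReal_onePointEstimate_le_exp hr hrr₀ hε hk hβ hN1
      (le_max_right _ _) hdiffd hexpd hbias hm hv hvlaw
    have htail := exp_tail_le hN1 hnN hε
    refine one_sub_le_measureReal_of_compl ?_ ?_
    · simp only [not_le]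
      linarith
    · simp only [not_le]
      linarith
  -- One of the two dimensions is `N`, so a maximum over both dominates the value at `N`.
  have hle : ∀ F : ℝ → ℝ, F N ≤ max (F dimΘ) (F dimD) := fun F => by
    rcases max_choice (dimΘ : ℝ) dimD with h | h
    · rw [hN, h]; exact le_max_left _ _
    · rw [hN, h]; exact le_max_right _ _
  have hmono : ∀ n : ℕ, (n : ℝ) ≤ N → hRad n (1 / ε) ≤ hRad N (1 / ε) := fun n hn => by
    simp only [hRad]
    gcongr
  rw [hp, hp, (max_le (hmono _ (le_max_left _ _)) (hmono _ (le_max_right _ _))).antisymm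
    (hle fun n => hRad n (1 / ε))] at hρ
  refine ⟨fun r m hr hrρ hm => ?_, fun m hm => ?_⟩
  · rw [hp₃, hp₃] at hm
    exact hmain r m hr (hρ ▸ hrρ) ((hle fun n => hSam n (1 / ε) (1 / r)).trans hm)
  · rw [hp', hp'] at hm
    refine hmain ρ m (hρ ▸ by positivity) hρ.le ?_
    rw [hρ, one_div_one_div]
    exact (hle fun n => hSam n (1 / ε) (hRad n (1 / ε))).trans hm
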